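/- **Theorem.** Let $G$ be a locally compact, $\sigma$-compact topological group which is amenable: if $\lambda$ denotes left Haar measure, then for every compact $K\subset G$ and every $\varepsilon>0$ there is a Borel set $F\subset G$ with $0<\lambda(F)<\infty$ and $\lambda(gF\,\Delta\,F)/\lambda(F)<\varepsilon$ for all $g\in K$. Let $\alpha_n$ ($n\in\mathbb N$) be an action of $G$ by isometries on a compact metric space $(X_n,d_n)$, and let $\alpha$ be an action of $G$ (not assumed to be by isometries) on a compact metric space $(X,d)$. (No continuity in the group variable is required of these actions.) For $\varepsilon>0$, an $\varepsilon$-isometry between metric spaces is a map $f:(Y,d_Y)\to(Z,d_Z)$, not necessarily continuous or measurable, such that $|d_Z(f(y),f(y'))-d_Y(y,y')|\le\varepsilon$ for all $y,y'\in Y$ and every point of $Z$ is at distance at most $\varepsilon$ from a point of $f(Y)$. For actions $\beta,\gamma$ of $G$ on $Y,Z$, let $d_{GH}(\beta,\gamma)\in[0,\infty]$ be the infimum of all $\varepsilon>0$ for which there are $\varepsilon$-isometries $f:Y\to Z$ and $h:Z\to Y$ with $d_Z(\gamma_g f(y),f(\beta_g y))\le\varepsilon$ and $d_Y(\beta_g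 h(z),h(\gamma_g z))\le\varepsilon$ for all $g\in G$, $y\in Y$, $z\in Z$ (with $\inf\varnothing=\infty$). For $p\ge 1$, let $P_p^G(X)$ be the set of $G$-invariant Borel probability measures $\mu$ on $X$ with $\int_X d(x,x_0)^p\,d\mu(x)<\infty$ for some $x_0\in X$, with the Wasserstein metric $$W_p(\mu,\nu)=\Big(\inf_{\pi}\int_{X\times X}d(x,y)^p\,d\pi(x,y)\Big)^{1/p},$$ where $\pi$ runs over all Borel probability measures on $X\times X$ with marginals $\mu$ and $\nu$; define $P_p^G(X_n)$ likewise. If $d_{GH}(\alpha_n,\alpha)\to 0$ as $n\to\infty$, then $\alpha$ is an action by isometries, and for every real $p\ge 1$ $$\lim_{n\to\infty}d_{GH}\big((P_p^G(X_n),W_p),(P_p^G(X),W_p)\big)=0,$$ where $d_{GH}$ between metric spaces is the Gromov–Hausdorff distance, i.e. the infimum of the Hausdorff distances between isometric copies of the two spaces in a common metric space. -/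

import Mathlib

open MeasureTheory Filter Topology
open scoped ENNReal

noncomputable section

/-- `G` is amenable: for every compact `K ⊆ G` and `ε > 0` there is a Borel set `F` with
`0 < λ(F) < ∞` and `λ(gF ∆ F) / λ(F) < ε` for all `g ∈ K`, where `λ` is left Haar measure
(the quotient does not depend on the normalization of `λ`). -/
def IsAmenableGroup (G : Type*) [Group G] [TopologicalSpace G] [IsTopologicalGroup G]
    [LocallyCompactSpace G] [MeasurableSpace G] [BorelSpace G] : Prop :=
  ∀ K : Set G, IsCompact K → ∀ ε : ℝ≥0∞, 0 < ε →
    ∃ F : Set G, MeasurableSet F ∧ 0 < (Measure.haar : Measure G) F ∧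
      (Measure.haar : Measure G) F < ∞ ∧
      ∀ g ∈ K, (Measure.haar : Measure G) (symmDiff ((fun x => g * x) '' F) F) /
        (Measure.haar : Measure G) F < ε

/-- An `ε`-isometry (equivalently an `ε`-Gromov-Hausdorff approximation) `f : X → Y`:
it distorts distances by at most `ε`, and every point of `Y` is within `ε` of the image. -/
def IsEpsIsometry {X Y : Type*} [MetricSpace X] [MetricSpace Y] (ε : ℝ) (f : X → Y) : Prop :=
  (∀ x x' : X, |dist (f x) (f x') - dist x x'| ≤ ε) ∧ ∀ y : Y, ∃ x : X, dist y (f x) ≤ ε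

/-- An `ε`-Gromov-Hausdorff approximation between two actions of `G`: an `ε`-isometry `f` with
`sup_x d(g • f x, f (g • x)) ≤ ε` for every `g : G`. It need not be measurable. -/
def IsEquivariantGHApprox (G : Type*) {X Y : Type*} [Group G] [MetricSpace X] [MetricSpace Y]
    [MulAction G X] [MulAction G Y] (ε : ℝ) (f : X → Y) : Prop :=
  IsEpsIsometry ε f ∧ ∀ (g : G) (x : X), dist (g • f x) (f (g • x)) ≤ ε

/-- The equivariant Gromov-Hausdorff distance between two actions of `G`: the infimum of the
`ε > 0` for which there are `ε`-approximations in both directions (`∞` if there is none). -/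
def equivariantGHDist (G X Y : Type*) [Group G] [MetricSpace X] [MetricSpace Y]
    [MulAction G X] [MulAction G Y] : ℝ≥0∞ :=
  ⨅ (ε : ℝ) (_ : 0 < ε) (_ : ∃ f : X → Y, IsEquivariantGHApprox G ε f)
    (_ : ∃ h : Y → X, IsEquivariantGHApprox G ε h), ENNReal.ofReal ε

/-- The Gromov-Hausdorff distance between a set `A` with metric `dA` and a set `B` with metric
`dB`: the infimum of the Hausdorff distances between distance-preserving copies of `A` and `B`
in a common metric space `Z`. The metrics are explicit arguments. If `dA` or `dB` is not a metric,
there is no such copy and the value is `∞`; so a finite value includes that they are metrics. -/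
def gromovHausdorffDist.{u, v} {A : Type u} {B : Type v} (dA : A → A → ℝ≥0∞)
    (dB : B → B → ℝ≥0∞) : ℝ≥0∞ :=
  ⨅ (Z : Type (max u v)) (_ : MetricSpace Z) (φ : A → Z) (ψ : B → Z)
    (_ : ∀ a a' : A, edist (φ a) (φ a') = dA a a')
    (_ : ∀ b b' : B, edist (ψ b) (ψ b') = dB b b'),
    Metric.hausdorffEDist (Set.range φ) (Set.range ψ)

/-- The couplings of `μ` and `ν`: measures on `X × X` with marginals `μ` and `ν`.
(They are probability measures when `μ` is.) -/
def couplings {X : Type*} [MeasurableSpace X] (μ ν : Measure X) : Set (Measure (X × X)) :=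
  {π | π.map Prod.fst = μ ∧ π.map Prod.snd = ν}

/-- The Wasserstein distance `W_p(μ, ν) = (inf_π ∫ d(x, y)^p dπ(x, y))^(1/p)`, the infimum being
over all couplings of `μ` and `ν`. -/
def wassersteinDist {X : Type*} [MetricSpace X] [MeasurableSpace X] (p : ℝ)
    (μ ν : Measure X) : ℝ≥0∞ :=
  (⨅ π ∈ couplings μ ν, ∫⁻ z, edist z.1 z.2 ^ p ∂π) ^ (1 / p)

/-- `P_p^G(X)`: the `G`-invariant probability measures on `X` with finite `p`-th moment. -/
def InvariantPp (G X : Type*) [Group G] [MetricSpace X] [MeasurableSpace X] [MulAction G X]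
    (p : ℝ) : Type _ :=
  {μ : Measure X // IsProbabilityMeasure μ ∧ (∃ x₀ : X, ∫⁻ x, edist x x₀ ^ p ∂μ < ∞) ∧
    SMulInvariantMeasure G X μ}

/-- The Wasserstein metric `W_p` on `P_p^G(X)`. -/
def InvariantPp.wDist (G X : Type*) [Group G] [MetricSpace X] [MeasurableSpace X] [MulAction G X]
    (p : ℝ) (μ ν : InvariantPp G X p) : ℝ≥0∞ :=
  wassersteinDist p μ.1 ν.1

end

/-!
An equivariant `ε`-approximation `f : X → Y` between isometric actions lets one put a metric on
`X ⊕ Y` extending the given ones, in which `x` is at distance `2ε` from `f x` and in which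
`d(g • x, g • y) = d(x, y)` for all `g` (`Metric.glueMetricApprox` along the `G`-orbit of the graph
of `f`). Since `W_p` is preserved by isometric embeddings (`wassersteinDist_map_eq`), the spaces
`P_p^G(X)` and `P_p^G(Y)` both sit isometrically in the space of all probability measures on
`X ⊕ Y` with the metric `W_p` (`wassersteinMetricSpace`), and it remains to bound their Hausdorff
distance there.

Given an invariant `μ` on `X`, transport it to `Y` by a measurable choice of nearby points. The
resulting coupling on `X × Y` has small cost but need not be invariant; averaging it over the
diagonal action of `G` keeps the first marginal `μ` and the cost, both being invariant, and makes
the second marginal an invariant measure on `Y` (`exists_invariant_wassersteinDist_le`).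

The average (`exists_invariant_average`) exists because an isometric action on a compact space is
totally bounded in the metric of uniform convergence. For each `r`, consider an `r`-net of `G` of
least cardinality. Any two such nets are matched, by Hall's marriage theorem, with displacement at
most `2r`, and translates of minimal nets are minimal nets; so the uniform averages over the nets
are asymptotically invariant, and any weak limit of them is invariant. This uses only the
total boundedness of the action, so that no measurability in the group variable is needed.

The limit action is isometric since each `y ↦ g • y` distorts distances by at most `4ε` whenever
there is an equivariant `ε`-approximation from `Y` to an isometric action
(`abs_dist_smul_sub_dist_le`).
-/

/-! ### Averaging over a group of isometries of a compact space -/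

/-- `t` is an `r`-net of `G` for the pseudometric `sup_w d(g • w, h • w)` given by the action
of `G` on `W`. -/
def IsActionNet {G : Type*} (W : Type*) [Group G] [MetricSpace W] [MulAction G W] (r : ℝ)
    (t : Finset G) : Prop :=
  ∀ g : G, ∃ a ∈ t, ∀ w : W, dist (g • w) (a • w) ≤ r

section Averaging

variable {G W : Type*} [Group G] [MetricSpace W] [MulAction G W]

/-- An isometric action on a compact space is totally bounded: it suffices to control the images
of the points of a finite net of `W`. -/
lemma exists_isActionNet [CompactSpace W] [IsIsometricSMul G W] {r : ℝ} (hr : 0 < r) :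
    ∃ t : Finset G, IsActionNet W r t := by
  classical
  obtain ⟨S, -, hSfin, hS⟩ :=
    (isCompact_univ (X := W)).totallyBounded.exists_subset
      (Metric.dist_mem_uniformity (by positivity : 0 < r / 3))
  have := hSfin.to_subtype
  have := Fintype.ofFinite S
  let F : G → S → W := fun g s => g • (s : W)
  have hF : TotallyBounded (Set.range F) :=
    (isCompact_univ (X := S → W)).totallyBounded.subset (Set.subset_univ _)
  obtain ⟨T, hTsub, hTfin, hT⟩ := hF.exists_subset
    (Metric.dist_mem_uniformity (by positivity : 0 < r / 3))
  choose! c hc using fun y (hy : y ∈ T) => hTsub hy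
  refine ⟨hTfin.toFinset.image c, fun g => ?_⟩
  obtain ⟨y, hy, hgy⟩ := Set.mem_iUnion₂.1 (hT ⟨g, rfl⟩)
  refine ⟨c y, Finset.mem_image_of_mem _ (hTfin.mem_toFinset.2 hy), fun w => ?_⟩
  obtain ⟨s, hs, hws⟩ := Set.mem_iUnion₂.1 (hS (Set.mem_univ w))
  have h1 : dist (g • w) (g • s) < r / 3 := by rw [dist_smul]; exact hws
  have h2 : dist (c y • s) (c y • w) < r / 3 := by rw [dist_smul, dist_comm]; exact hws
  have h3 : dist (g • s) (c y • s) < r / 3 := by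
    have := (dist_le_pi_dist (F g) (F (c y)) ⟨s, hs⟩).trans_lt (by rw [hc y hy]; exact hgy)
    exact this
  linarith [dist_triangle4 (g • w) (g • s) (c y • s) (c y • w)]

/-- A net of least cardinality. -/
lemma exists_minimal_isActionNet [CompactSpace W] [IsIsometricSMul G W] {r : ℝ} (hr : 0 < r) :
    ∃ t : Finset G, IsActionNet W r t ∧ ∀ t' : Finset G, IsActionNet W r t' → t.card ≤ t'.card := by
  obtain ⟨t, ht, hmin⟩ := (measure (Finset.card : Finset G → ℕ)).wf.has_min
    {t | IsActionNet W r t} (exists_isActionNet hr)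
  exact ⟨t, ht, fun t' ht' => not_lt.1 (hmin t' ht')⟩

/-- Two `r`-nets of least cardinality can be matched with displacement at most `2r`. The condition
of Hall's theorem holds because otherwise exchanging a set of points of `s` for its neighbours
in `t` would yield a smaller net. -/
lemma exists_matching_of_minimal {r : ℝ} {s t : Finset G}
    (hs : IsActionNet W r s) (hsmin : ∀ t' : Finset G, IsActionNet W r t' → s.card ≤ t'.card)
    (ht : IsActionNet W r t) (hcard : t.card ≤ s.card) :
    ∃ e : s ≃ t, ∀ a : s, ∀ w : W, dist ((a : G) • w) ((e a : G) • w) ≤ 2 * r := by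
  classical
  let N : s → Finset t := fun a =>
    Finset.univ.filter fun b => ∀ w : W, dist ((a : G) • w) ((b : G) • w) ≤ 2 * r
  have hall : ∀ A : Finset s, A.card ≤ (A.biUnion N).card := by
    intro A
    let A' : Finset G := A.map (Function.Embedding.subtype _)
    let B' : Finset G := (A.biUnion N).map (Function.Embedding.subtype _)
    have hA' : A' ⊆ s := by
      intro a ha
      obtain ⟨a, -, rfl⟩ := Finset.mem_map.1 ha
      exact a.2
    have hnet : IsActionNet W r ((s \ A') ∪ B') := by
      intro g
      obtain ⟨a, ha, hga⟩ := hs g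
      by_cases haA : a ∈ A'
      · obtain ⟨b, hb, hgb⟩ := ht g
        refine ⟨b, Finset.mem_union_right _ ?_, hgb⟩
        obtain ⟨a, haA', rfl⟩ := Finset.mem_map.1 haA
        refine Finset.mem_map.2 ⟨⟨b, hb⟩, Finset.mem_biUnion.2 ⟨a, haA', ?_⟩, rfl⟩
        refine Finset.mem_filter.2 ⟨Finset.mem_univ _, fun w => ?_⟩
        have h1 := hga w
        have h2 := hgb w
        have h3 := dist_triangle_left ((a : G) • w) (b • w) (g • w)
        simp only [Function.Embedding.subtype_apply] at h1
        linarith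
      · exact ⟨a, Finset.mem_union_left _ (Finset.mem_sdiff.2 ⟨ha, haA⟩), hga⟩
    have h1 := hsmin _ hnet
    have h2 := Finset.card_union_le (s \ A') B'
    have h3 := Finset.card_sdiff_add_card_eq_card hA'
    have h4 : A'.card = A.card := Finset.card_map _
    have h5 : B'.card = (A.biUnion N).card := Finset.card_map _
    omega
  obtain ⟨f, hf, hfN⟩ := (Finset.all_card_le_biUnion_card_iff_exists_injective N).1 hall
  have hbij : Function.Bijective f := by
    refine (Fintype.bijective_iff_injective_and_card f).2 ⟨hf, ?_⟩
    simpa using le_antisymm (hsmin t ht) hcard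
  exact ⟨Equiv.ofBijective f hbij, fun a => (Finset.mem_filter.1 (hfN a)).2⟩

/-- Averages over a net of least cardinality are nearly invariant under translation. -/
lemma abs_sum_mul_left_sub_sum_le [IsIsometricSMul G W] {r η : ℝ} {t : Finset G}
    (ht : IsActionNet W r t) (htmin : ∀ t' : Finset G, IsActionNet W r t' → t.card ≤ t'.card)
    {φ : G → ℝ}
    (hφ : ∀ g h : G, (∀ w : W, dist (g • w) (h • w) ≤ 2 * r) → |φ g - φ h| ≤ η) (k : G) :
    |∑ a ∈ t, φ (k * a) - ∑ a ∈ t, φ a| ≤ t.card * η := by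
  classical
  let s : Finset G := t.map (Equiv.mulLeft k).toEmbedding
  have hscard : s.card = t.card := Finset.card_map _
  have hs : IsActionNet W r s := by
    intro g
    obtain ⟨a, ha, hga⟩ := ht (k⁻¹ * g)
    refine ⟨k * a, Finset.mem_map.2 ⟨a, ha, rfl⟩, fun w => ?_⟩
    have h := hga w
    rwa [← dist_smul k, ← mul_smul, ← mul_smul, mul_inv_cancel_left] at h
  obtain ⟨e, he⟩ := exists_matching_of_minimal hs (fun t' h => hscard ▸ htmin t' h) ht hscard.ge
  have h1 : ∑ a ∈ t, φ (k * a) = ∑ a : s, φ a := by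
    rw [Finset.sum_coe_sort s φ, Finset.sum_map]
    rfl
  have h2 : ∑ a ∈ t, φ a = ∑ a : s, φ (e a) := by
    rw [← Finset.sum_coe_sort t φ]
    exact (Equiv.sum_comp e fun b : t => φ b).symm
  rw [h1, h2, ← Finset.sum_sub_distrib]
  refine (Finset.abs_sum_le_sum_abs _ _).trans ?_
  refine (Finset.sum_le_card_nsmul _ _ η fun a _ => hφ _ _ (he a)).trans ?_
  simp [hscard]

/-- An isometric action on a compact space admits averaging: a probability measure `π₀` can be
replaced by an invariant one with the same integral for every `f` whose `π₀`-integral does not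
change when `f` is translated. It is a limit of the averages of the translates of `π₀` over finer
and finer nets of least cardinality. -/
theorem exists_invariant_average [CompactSpace W] [MeasurableSpace W] [BorelSpace W]
    [IsIsometricSMul G W] (π₀ : Measure W) [IsProbabilityMeasure π₀] :
    ∃ π : Measure W, IsProbabilityMeasure π ∧ SMulInvariantMeasure G W π ∧
      ∀ (f : BoundedContinuousFunction W ℝ) (c : ℝ),
        (∀ g : G, ∫ w, f (g • w) ∂π₀ = c) → ∫ w, f w ∂π = c := by
  classical
  have hcont : ∀ g : G, Continuous fun w : W => g • w := fun g => (isometry_smul W g).continuous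
  have hmeas : ∀ g : G, Measurable fun w : W => g • w := fun g => (hcont g).measurable
  have hint : ∀ (f : BoundedContinuousFunction W ℝ) (g : G),
      Integrable (fun w => f (g • w)) π₀ := fun f g =>
    (f.compContinuous ⟨_, hcont g⟩).integrable π₀
  have hr : ∀ n : ℕ, (0 : ℝ) < 1 / ((n : ℝ) + 1) := fun n => Nat.one_div_pos_of_nat
  choose t ht htmin using fun n => exists_minimal_isActionNet (G := G) (W := W) (hr n)
  have hcard : ∀ n, 0 < (t n).card := fun n => by
    obtain ⟨a, ha, -⟩ := ht n 1
    exact Finset.card_pos.2 ⟨a, ha⟩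
  let P : ℕ → Measure W := fun n =>
    ((t n).card : ℝ≥0∞)⁻¹ • ∑ a ∈ t n, π₀.map (fun w => a • w)
  have hP : ∀ n, IsProbabilityMeasure (P n) := fun n => by
    constructor
    have : ∀ a : G, π₀.map (fun w => a • w) Set.univ = 1 := fun a => by
      rw [Measure.map_apply (hmeas a) MeasurableSet.univ]
      simp
    simp only [P, Measure.smul_apply, Measure.finsetSum_apply, this, smul_eq_mul,
      Finset.sum_const, nsmul_eq_mul, mul_one]
    exact ENNReal.inv_mul_cancel (by exact_mod_cast (hcard n).ne') (ENNReal.natCast_ne_top _)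
  have hPint : ∀ n (f : BoundedContinuousFunction W ℝ),
      ∫ w, f w ∂(P n) = ((t n).card : ℝ)⁻¹ * ∑ a ∈ t n, ∫ w, f (a • w) ∂π₀ := fun n f => by
    have : ∀ a : G, IsProbabilityMeasure (π₀.map (fun w => a • w)) := fun a =>
      Measure.isProbabilityMeasure_map (hmeas a).aemeasurable
    rw [integral_smul_measure, integral_finsetSum_measure fun a _ => f.integrable _]
    simp only [ENNReal.toReal_inv, ENNReal.toReal_natCast, smul_eq_mul]
    congr 1
    refine Finset.sum_congr rfl fun a _ => ?_
    rw [integral_map (hmeas a).aemeasurable f.continuous.aestronglyMeasurable]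
  let U : Ultrafilter ℕ := Ultrafilter.of atTop
  have hU : (U : Filter ℕ) ≤ atTop := Ultrafilter.of_le _
  let Q : ℕ → ProbabilityMeasure W := fun n => ⟨P n, hP n⟩
  obtain ⟨π, -, hπ⟩ := (isCompact_univ (X := ProbabilityMeasure W)).ultrafilter_le_nhds
    (U.map Q) (by simp)
  have hlim : ∀ f : BoundedContinuousFunction W ℝ,
      Tendsto (fun n => ∫ w, f w ∂(P n)) U (𝓝 (∫ w, f w ∂(π : Measure W))) :=
    ProbabilityMeasure.tendsto_iff_forall_integral_tendsto.1 hπ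
  refine ⟨π, inferInstance, ⟨fun k A hA => ?_⟩, fun f c hc => ?_⟩
  · have : IsProbabilityMeasure ((π : Measure W).map fun w => k • w) :=
      Measure.isProbabilityMeasure_map (hmeas k).aemeasurable
    suffices h : (π : Measure W).map (fun w => k • w) = π by
      rw [← Measure.map_apply (hmeas k) hA, h]
    refine ext_of_forall_integral_eq_of_IsFiniteMeasure fun f => ?_
    rw [integral_map (hmeas k).aemeasurable f.continuous.aestronglyMeasurable]
    let fk : BoundedContinuousFunction W ℝ := f.compContinuous ⟨_, hcont k⟩
    have hdiff := (hlim fk).sub (hlim f)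
    have hzero : Tendsto (fun n => ∫ w, fk w ∂(P n) - ∫ w, f w ∂(P n)) atTop (𝓝 0) := by
      rw [Metric.tendsto_atTop]
      intro ε hε
      obtain ⟨δ, hδ, hfδ⟩ := Metric.uniformContinuous_iff.1
        (CompactSpace.uniformContinuous_of_continuous f.continuous) (ε / 2) (half_pos hε)
      obtain ⟨m, hm⟩ := exists_nat_one_div_lt (half_pos hδ)
      refine ⟨m, fun n hn => ?_⟩
      have hrn : 2 * (1 / ((n : ℝ) + 1)) < δ := by
        have := one_div_le_one_div_of_le (by positivity : (0 : ℝ) < m + 1)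
          (by gcongr : (m : ℝ) + 1 ≤ n + 1)
        linarith
      have hφ : ∀ g h : G, (∀ w : W, dist (g • w) (h • w) ≤ 2 * (1 / ((n : ℝ) + 1))) →
          |∫ w, f (g • w) ∂π₀ - ∫ w, f (h • w) ∂π₀| ≤ ε / 2 := fun g h hgh => by
        rw [← integral_sub (hint f g) (hint f h), ← Real.norm_eq_abs]
        have := norm_integral_le_of_norm_le_const (μ := π₀) (C := ε / 2)
          (f := fun w => f (g • w) - f (h • w))
          (ae_of_all _ fun w => by
            rw [← dist_eq_norm]
            exact (hfδ ((hgh w).trans_lt hrn)).le)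
        simpa using this
      have key := abs_sum_mul_left_sub_sum_le (ht n) (htmin n) hφ k
      have hc : (0 : ℝ) < (t n).card := by exact_mod_cast hcard n
      have hfk : ∀ a : G, ∫ w, fk (a • w) ∂π₀ = ∫ w, f ((k * a) • w) ∂π₀ := fun a => by
        simp only [mul_smul]
        rfl
      rw [Real.dist_0_eq_abs, hPint, hPint, ← mul_sub, abs_mul, abs_of_pos (inv_pos.2 hc)]
      simp only [hfk]
      calc _ ≤ ((t n).card : ℝ)⁻¹ * ((t n).card * (ε / 2)) := by gcongr
        _ = ε / 2 := by field_simp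
        _ < ε := half_lt_self hε
    exact sub_eq_zero.1 (tendsto_nhds_unique hdiff (hzero.mono_left hU))
  · refine tendsto_nhds_unique (hlim f) ?_
    have : (fun n => ∫ w, f w ∂(P n)) = fun _ => c := by
      funext n
      have hn : ((t n).card : ℝ) ≠ 0 := by exact_mod_cast (hcard n).ne'
      rw [hPint]
      simp [hc, hn]
    rw [this]
    exact tendsto_const_nhds

end Averaging

/-! ### The Wasserstein metric on a compact space -/

section Wasserstein

variable {Z : Type*} [MetricSpace Z] [MeasurableSpace Z] {p : ℝ}

lemma wassersteinDist_le_of_mem_couplings {μ ν : Measure Z} {π : Measure (Z × Z)} (hp : 0 < p)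
    (hπ : π ∈ couplings μ ν) :
    wassersteinDist p μ ν ≤ (∫⁻ z, edist z.1 z.2 ^ p ∂π) ^ (1 / p) :=
  ENNReal.rpow_le_rpow (iInf₂_le π hπ) (by positivity)

lemma exists_mem_couplings_of_wassersteinDist_lt {μ ν : Measure Z} (hp : 0 < p) {a : ℝ≥0∞}
    (h : wassersteinDist p μ ν < a) :
    ∃ π ∈ couplings μ ν, (∫⁻ z, edist z.1 z.2 ^ p ∂π) ^ (1 / p) < a := by
  rw [wassersteinDist, one_div, ENNReal.rpow_inv_lt_iff hp] at h
  simp only [iInf_lt_iff] at h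
  obtain ⟨π, hπ, hlt⟩ := h
  exact ⟨π, hπ, by rwa [one_div, ENNReal.rpow_inv_lt_iff hp]⟩

lemma wassersteinDist_comm_le [OpensMeasurableSpace Z] [SecondCountableTopology Z] (hp : 0 < p)
    (μ ν : Measure Z) : wassersteinDist p μ ν ≤ wassersteinDist p ν μ := by
  refine le_of_forall_gt fun a ha => ?_
  obtain ⟨π, ⟨h1, h2⟩, hlt⟩ := exists_mem_couplings_of_wassersteinDist_lt hp ha
  refine (wassersteinDist_le_of_mem_couplings hp (π := π.map Prod.swap) ⟨?_, ?_⟩).trans_lt ?_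
  · rw [Measure.map_map measurable_fst measurable_swap]
    exact h2
  · rw [Measure.map_map measurable_snd measurable_swap]
    exact h1
  · rw [lintegral_map (by fun_prop) measurable_swap]
    simpa [edist_comm] using hlt

lemma wassersteinDist_comm [OpensMeasurableSpace Z] [SecondCountableTopology Z] (hp : 0 < p)
    (μ ν : Measure Z) : wassersteinDist p μ ν = wassersteinDist p ν μ :=
  le_antisymm (wassersteinDist_comm_le hp μ ν) (wassersteinDist_comm_le hp ν μ)

lemma wassersteinDist_self [OpensMeasurableSpace Z] [SecondCountableTopology Z] (hp : 0 < p)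
    (μ : Measure Z) : wassersteinDist p μ μ = 0 := by
  have hdiag : Measurable fun z : Z => (z, z) := by fun_prop
  refine le_antisymm ((wassersteinDist_le_of_mem_couplings hp
    (π := μ.map fun z => (z, z)) ⟨?_, ?_⟩).trans ?_) zero_le
  · rw [Measure.map_map measurable_fst hdiag]
    exact Measure.map_id
  · rw [Measure.map_map measurable_snd hdiag]
    exact Measure.map_id
  · rw [lintegral_map (by fun_prop) hdiag]
    simp [hp]

lemma wassersteinDist_ne_top [CompactSpace Z] (hp : 0 < p) (μ ν : Measure Z)
    [IsProbabilityMeasure μ] [IsProbabilityMeasure ν] : wassersteinDist p μ ν ≠ ∞ := by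
  have hdiam : Metric.ediam (Set.univ : Set Z) ≠ ∞ :=
    Metric.isBounded_iff_ediam_ne_top.1 isCompact_univ.isBounded
  refine ((wassersteinDist_le_of_mem_couplings hp (π := μ.prod ν) ⟨?_, ?_⟩).trans_lt ?_).ne
  · simp
  · simp
  · refine ENNReal.rpow_lt_top_of_nonneg (by positivity) ?_
    refine ((lintegral_mono fun z : Z × Z => ENNReal.rpow_le_rpow
      (Metric.edist_le_ediam_of_mem (Set.mem_univ z.1) (Set.mem_univ z.2)) hp.le).trans_lt ?_).ne
    simpa using ENNReal.rpow_lt_top_of_nonneg hp.le hdiam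

/-- Two couplings with a common marginal `ν` glue to a measure on triples `(y, x, z)`, where `y`
has law `ν`: disintegrate both over `ν` and make `x` and `z` conditionally independent. -/
lemma exists_gluing {Z : Type*} [MeasurableSpace Z] [StandardBorelSpace Z] [Nonempty Z]
    {μ ν ρ : Measure Z}
    {π₁ π₂ : Measure (Z × Z)} [IsFiniteMeasure π₁] [IsFiniteMeasure π₂]
    (h₁ : π₁ ∈ couplings μ ν) (h₂ : π₂ ∈ couplings ν ρ) :
    ∃ γ : Measure (Z × Z × Z), γ.map (fun w => (w.2.1, w.1)) = π₁ ∧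
      γ.map (fun w => (w.1, w.2.2)) = π₂ := by
  let σ : Measure (Z × Z) := π₁.map Prod.swap
  have hσ : σ.fst = ν := by
    rw [Measure.fst, Measure.map_map measurable_fst measurable_swap]
    exact h₁.2
  have hπ₂ : π₂.fst = ν := h₂.1
  have : IsFiniteMeasure ν := hσ ▸ inferInstance
  let γ : Measure (Z × Z × Z) := ν.compProd (σ.condKernel.prod π₂.condKernel)
  have e1 : γ.map (Prod.map id Prod.fst) = σ := by
    rw [← Measure.compProd_map measurable_fst, ← ProbabilityTheory.Kernel.fst_eq,
      ProbabilityTheory.Kernel.fst_prod, ← hσ]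
    exact σ.disintegrate σ.condKernel
  have e2 : γ.map (Prod.map id Prod.snd) = π₂ := by
    rw [← Measure.compProd_map measurable_snd, ← ProbabilityTheory.Kernel.snd_eq,
      ProbabilityTheory.Kernel.snd_prod, ← hπ₂]
    exact π₂.disintegrate π₂.condKernel
  refine ⟨γ, ?_, e2⟩
  have : (fun w : Z × Z × Z => (w.2.1, w.1)) = Prod.swap ∘ Prod.map id Prod.fst := rfl
  rw [this, ← Measure.map_map measurable_swap (by fun_prop), e1,
    Measure.map_map measurable_swap measurable_swap]
  simp

lemma isFiniteMeasure_of_mem_couplings {Z : Type*} [MeasurableSpace Z]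
    {μ ν : Measure Z} [IsFiniteMeasure μ] {π : Measure (Z × Z)} (h : π ∈ couplings μ ν) : IsFiniteMeasure π := by
  have : IsFiniteMeasure (π.map Prod.fst) := h.1.symm ▸ inferInstance
  exact Measure.isFiniteMeasure_of_map measurable_fst.aemeasurable

lemma wassersteinDist_triangle [BorelSpace Z] [CompactSpace Z] (hp : 1 ≤ p)
    (μ ν ρ : Measure Z) [IsProbabilityMeasure μ] [IsProbabilityMeasure ν] :
    wassersteinDist p μ ρ ≤ wassersteinDist p μ ν + wassersteinDist p ν ρ := by
  have hp0 : 0 < p := by linarith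
  have : Nonempty Z := nonempty_of_isProbabilityMeasure μ
  refine ENNReal.le_of_forall_pos_le_add fun ε hε hfin => ?_
  obtain ⟨hf1, hf2⟩ := ENNReal.add_lt_top.1 hfin
  have hε2 : (ε / 2 : ℝ≥0∞) ≠ 0 := by simpa using hε.ne'
  obtain ⟨π₁, h₁, hlt₁⟩ := exists_mem_couplings_of_wassersteinDist_lt hp0
    (ENNReal.lt_add_right hf1.ne hε2)
  obtain ⟨π₂, h₂, hlt₂⟩ := exists_mem_couplings_of_wassersteinDist_lt hp0
    (ENNReal.lt_add_right hf2.ne hε2)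
  have := isFiniteMeasure_of_mem_couplings h₁
  have := isFiniteMeasure_of_mem_couplings h₂
  obtain ⟨γ, hγ₁, hγ₂⟩ := exists_gluing h₁ h₂
  have hmem : γ.map (fun w => w.2) ∈ couplings μ ρ := by
    constructor
    · rw [Measure.map_map measurable_fst measurable_snd, ← h₁.1, ← hγ₁,
        Measure.map_map measurable_fst (by fun_prop)]
      rfl
    · rw [Measure.map_map measurable_snd measurable_snd, ← h₂.2, ← hγ₂,
        Measure.map_map measurable_snd (by fun_prop)]
      rfl
  calc wassersteinDist p μ ρ ≤ (∫⁻ z, edist z.1 z.2 ^ p ∂(γ.map fun w => w.2)) ^ (1 / p) :=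
        wassersteinDist_le_of_mem_couplings hp0 hmem
    _ = (∫⁻ w, edist w.2.1 w.2.2 ^ p ∂γ) ^ (1 / p) := by
        rw [lintegral_map (by fun_prop) measurable_snd]
    _ ≤ (∫⁻ w, ((fun w : Z × Z × Z => edist w.2.1 w.1) +
          fun w : Z × Z × Z => edist w.1 w.2.2) w ^ p ∂γ) ^ (1 / p) := by
        refine ENNReal.rpow_le_rpow (lintegral_mono fun w => ?_) (by positivity)
        exact ENNReal.rpow_le_rpow (edist_triangle _ _ _) hp0.le
    _ ≤ (∫⁻ w, edist w.2.1 w.1 ^ p ∂γ) ^ (1 / p) + (∫⁻ w, edist w.1 w.2.2 ^ p ∂γ) ^ (1 / p) :=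
        ENNReal.lintegral_Lp_add_le (by fun_prop) (by fun_prop) hp
    _ = (∫⁻ z, edist z.1 z.2 ^ p ∂π₁) ^ (1 / p) + (∫⁻ z, edist z.1 z.2 ^ p ∂π₂) ^ (1 / p) := by
        rw [← hγ₁, ← hγ₂, lintegral_map (by fun_prop) (by fun_prop),
          lintegral_map (by fun_prop) (by fun_prop)]
    _ ≤ (wassersteinDist p μ ν + ε / 2) + (wassersteinDist p ν ρ + ε / 2) :=
        add_le_add hlt₁.le hlt₂.le
    _ = wassersteinDist p μ ν + wassersteinDist p ν ρ + ε := by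
        rw [add_add_add_comm, ENNReal.add_halves]

/-- If `W_p(μ, ν) = 0` then `ν` charges every neighbourhood of a closed set `F` at least as much
as `μ` charges `F`, by Markov's inequality for `d(x, y) ^ p` under a nearly optimal coupling. -/
lemma measure_le_of_wassersteinDist_eq_zero [BorelSpace Z] [SecondCountableTopology Z]
    (hp : 0 < p) {μ ν : Measure Z} [IsFiniteMeasure ν] (h : wassersteinDist p μ ν = 0)
    {F : Set Z} (hF : IsClosed F) : μ F ≤ ν F := by
  have key : ∀ δ : ℝ, 0 < δ → μ F ≤ ν (Metric.cthickening δ F) := by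
    intro δ hδ
    have hδ' : ENNReal.ofReal δ ^ p ≠ 0 := by
      simp [ENNReal.rpow_eq_zero_iff, hδ, hp, hp.not_gt]
    have hδt : ENNReal.ofReal δ ^ p ≠ ∞ := ENNReal.rpow_ne_top_of_nonneg hp.le ENNReal.ofReal_ne_top
    refine ENNReal.le_of_forall_pos_le_add fun η hη _ => ?_
    have hpos : 0 < (ENNReal.ofReal δ ^ p * η) ^ (1 / p) :=
      ENNReal.rpow_pos (ENNReal.mul_pos hδ' (by exact_mod_cast hη.ne'))
        (ENNReal.mul_ne_top hδt ENNReal.coe_ne_top)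
    obtain ⟨π, ⟨h1, h2⟩, hlt⟩ := exists_mem_couplings_of_wassersteinDist_lt hp (h ▸ hpos)
    rw [ENNReal.rpow_lt_rpow_iff (by positivity)] at hlt
    have hmarkov : π {z | ENNReal.ofReal δ ^ p ≤ edist z.1 z.2 ^ p} ≤ η := by
      have := (mul_meas_ge_le_lintegral (μ := π)
        (f := fun z : Z × Z => edist z.1 z.2 ^ p) (by fun_prop) (ENNReal.ofReal δ ^ p)).trans hlt.le
      exact (ENNReal.mul_le_mul_iff_right hδ' hδt).1 this
    calc μ F = π (Prod.fst ⁻¹' F) := by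
          rw [← h1, Measure.map_apply measurable_fst hF.measurableSet]
      _ ≤ π (Prod.snd ⁻¹' Metric.cthickening δ F ∪
            {z | ENNReal.ofReal δ ^ p ≤ edist z.1 z.2 ^ p}) := by
          refine measure_mono fun z hz => ?_
          by_cases hd : edist z.1 z.2 < ENNReal.ofReal δ
          · refine Or.inl (Metric.mem_cthickening_of_edist_le z.2 z.1 δ F hz ?_)
            rw [edist_comm]
            exact hd.le
          · exact Or.inr (ENNReal.rpow_le_rpow (not_lt.1 hd) hp.le)
      _ ≤ ν (Metric.cthickening δ F) + η := by
          refine (measure_union_le _ _).trans (add_le_add ?_ hmarkov)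
          rw [← h2, Measure.map_apply measurable_snd Metric.isClosed_cthickening.measurableSet]
  have hlim := tendsto_measure_cthickening_of_isClosed (μ := ν) (s := F)
    ⟨1, one_pos, measure_ne_top _ _⟩ hF
  exact ge_of_tendsto (hlim.mono_left nhdsWithin_le_nhds)
    (eventually_nhdsWithin_of_forall (s := Set.Ioi (0 : ℝ)) fun δ hδ => key δ hδ)

lemma eq_of_wassersteinDist_eq_zero [BorelSpace Z] [SecondCountableTopology Z]
    (hp : 0 < p) {μ ν : Measure Z} [IsProbabilityMeasure μ] [IsProbabilityMeasure ν]
    (h : wassersteinDist p μ ν = 0) : μ = ν := by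
  refine ext_of_generate_finite _ ((BorelSpace.measurable_eq (α := Z)).trans
    borel_eq_generateFrom_isClosed) isPiSystem_isClosed (fun F hF => ?_) (by simp)
  exact le_antisymm (measure_le_of_wassersteinDist_eq_zero hp h hF)
    (measure_le_of_wassersteinDist_eq_zero hp (wassersteinDist_comm hp μ ν ▸ h) hF)

/-- The metric space of all probability measures on a compact space with the metric `W_p`. It is
not an instance: its topology is not definitionally the weak topology of `ProbabilityMeasure`. -/
noncomputable abbrev wassersteinMetricSpace (Z : Type*) [MetricSpace Z]
    [MeasurableSpace Z] [BorelSpace Z] [CompactSpace Z] {p : ℝ} (hp : 1 ≤ p) : MetricSpace (ProbabilityMeasure Z) :=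
  have hp0 : 0 < p := by linarith
  letI : EMetricSpace (ProbabilityMeasure Z) :=
    { edist := fun μ ν => wassersteinDist p (μ : Measure Z) ν
      edist_self := fun _ => wassersteinDist_self hp0 _
      edist_comm := fun _ _ => wassersteinDist_comm hp0 _ _
      edist_triangle := fun μ ν ρ =>
        wassersteinDist_triangle hp (μ : Measure Z) (ν : Measure Z) (ρ : Measure Z)
      eq_of_edist_eq_zero := fun {μ ν} h => Subtype.ext <|
        eq_of_wassersteinDist_eq_zero hp0 (μ := (μ : Measure Z)) (ν := (ν : Measure Z)) h }
  EMetricSpace.toMetricSpace fun _ _ => wassersteinDist_ne_top hp0 _ _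

/-- An isometric embedding of compact spaces preserves `W_p`: a coupling of the image measures is
carried by the image, hence can be pulled back by a measurable left inverse. -/
lemma wassersteinDist_map_eq {X : Type*} [MetricSpace X] [MeasurableSpace X] [BorelSpace X]
    [CompactSpace X] [BorelSpace Z] [CompactSpace Z] (hp : 0 < p) {i : X → Z} (hi : Isometry i)
    (μ ν : Measure X) [IsProbabilityMeasure μ] :
    wassersteinDist p (μ.map i) (ν.map i) = wassersteinDist p μ ν := by
  have him : Measurable i := hi.continuous.measurable
  have hemb : MeasurableEmbedding i := hi.isClosedEmbedding.measurableEmbedding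
  have : Nonempty X := nonempty_of_isProbabilityMeasure μ
  obtain ⟨r, hr, hri⟩ := hemb.exists_measurable_extend measurable_id fun _ => ‹Nonempty X›
  refine le_antisymm (le_of_forall_gt fun a ha => ?_) (le_of_forall_gt fun a ha => ?_)
  · obtain ⟨π, ⟨h1, h2⟩, hlt⟩ := exists_mem_couplings_of_wassersteinDist_lt hp ha
    refine (wassersteinDist_le_of_mem_couplings hp (π := π.map (Prod.map i i))
      ⟨?_, ?_⟩).trans_lt ?_
    · rw [Measure.map_map measurable_fst (by fun_prop), ← h1,
        Measure.map_map him measurable_fst]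
      rfl
    · rw [Measure.map_map measurable_snd (by fun_prop), ← h2,
        Measure.map_map him measurable_snd]
      rfl
    · rw [lintegral_map (by fun_prop) (by fun_prop)]
      simpa [hi.edist_eq] using hlt
  · obtain ⟨π, ⟨h1, h2⟩, hlt⟩ := exists_mem_couplings_of_wassersteinDist_lt hp ha
    have hri' : ∀ x, r (i x) = x := congr_fun hri
    have hrμ : ∀ μ : Measure X, (μ.map i).map r = μ := fun μ => by
      rw [Measure.map_map hr him, hri, Measure.map_id]
    have hrange : ∀ μ : Measure X, ∀ᵐ z ∂(μ.map i), z ∈ Set.range i := fun μ =>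
      (ae_map_iff him.aemeasurable hemb.measurableSet_range).2 (ae_of_all _ fun x => ⟨x, rfl⟩)
    have hfst : ∀ᵐ z ∂π, z.1 ∈ Set.range i :=
      ae_of_ae_map measurable_fst.aemeasurable (h1.symm ▸ hrange μ)
    have hsnd : ∀ᵐ z ∂π, z.2 ∈ Set.range i :=
      ae_of_ae_map measurable_snd.aemeasurable (h2.symm ▸ hrange ν)
    refine (wassersteinDist_le_of_mem_couplings hp (π := π.map (Prod.map r r))
      ⟨?_, ?_⟩).trans_lt ?_
    · rw [Measure.map_map measurable_fst (by fun_prop), ← hrμ μ, ← h1,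
        Measure.map_map hr measurable_fst]
      rfl
    · rw [Measure.map_map measurable_snd (by fun_prop), ← hrμ ν, ← h2,
        Measure.map_map hr measurable_snd]
      rfl
    · rw [lintegral_map (by fun_prop) (by fun_prop)]
      refine lt_of_eq_of_lt ?_ hlt
      congr 1
      refine lintegral_congr_ae ?_
      filter_upwards [hfst, hsnd]
      rintro ⟨_, _⟩ ⟨x, rfl⟩ ⟨y, rfl⟩
      simp [hri', hi.edist_eq]

end Wasserstein

/-! ### Comparing invariant measures in a common metric space -/

/-- A measurable choice of nearby points: the first sufficiently close point of a dense
sequence. -/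
lemma exists_measurable_dist_lt {X Y Z : Type*} [MetricSpace X] [MeasurableSpace X]
    [OpensMeasurableSpace X] [MetricSpace Y] [CompactSpace Y] [MeasurableSpace Y]
    [MetricSpace Z] {i : X → Z} {j : Y → Z} (hi : Continuous i)
    (hj : Continuous j) {δ : ℝ} (h : ∀ x, ∃ y, dist (i x) (j y) < δ) :
    ∃ s : X → Y, Measurable s ∧ ∀ x, dist (i x) (j (s x)) < δ := by
  classical
  rcases isEmpty_or_nonempty X with hX | ⟨⟨x₀⟩⟩
  · exact ⟨fun x => hX.elim x, measurable_of_empty _, fun x => hX.elim x⟩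
  have : Nonempty Y := ⟨(h x₀).choose⟩
  have hseq : ∀ x, ∃ n : ℕ, dist (i x) (j (TopologicalSpace.denseSeq Y n)) < δ := fun x => by
    obtain ⟨y, hy⟩ := (TopologicalSpace.denseRange_denseSeq Y).exists_mem_open
      (isOpen_lt (f := fun y => dist (i x) (j y)) (by fun_prop) continuous_const) (h x)
    exact ⟨y, hy⟩
  refine ⟨fun x => TopologicalSpace.denseSeq Y (Nat.find (hseq x)), ?_,
    fun x => Nat.find_spec (hseq x)⟩
  refine (measurable_from_nat (f := TopologicalSpace.denseSeq Y)).comp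
    (measurable_find hseq fun n => ?_)
  exact (isOpen_lt (by fun_prop) continuous_const).measurableSet

/-- On a nonempty compact space the moment condition in `InvariantPp` is automatic. -/
lemma exists_lintegral_edist_rpow_lt_top {X : Type*} [MetricSpace X] [CompactSpace X]
    [MeasurableSpace X] {p : ℝ} (hp : 0 < p) (μ : Measure X)
    [IsProbabilityMeasure μ] : ∃ x₀ : X, ∫⁻ x, edist x x₀ ^ p ∂μ < ∞ := by
  obtain ⟨x₀⟩ : Nonempty X := nonempty_of_isProbabilityMeasure μ
  refine ⟨x₀, (lintegral_mono fun x => ENNReal.rpow_le_rpow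
    (Metric.edist_le_ediam_of_mem (Set.mem_univ x) (Set.mem_univ x₀)) hp.le).trans_lt ?_⟩
  simpa using ENNReal.rpow_lt_top_of_nonneg hp.le
    (Metric.isBounded_iff_ediam_ne_top.1 (isCompact_univ (X := X)).isBounded)

section Comparison

variable {G X Y Z : Type*} [Group G]
  [MetricSpace X] [CompactSpace X] [MeasurableSpace X] [BorelSpace X] [MulAction G X]
  [MetricSpace Y] [CompactSpace Y] [MeasurableSpace Y] [BorelSpace Y] [MulAction G Y]

/-- Suppose `X` and `Y` are embedded in a space `Z` so that `d(i x, j y)` is `G`-invariant and every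
`i x` is within `δ` of the image of `j`. Then every invariant measure on `X` is `W_p`-close to
one on `Y`: transport `μ` to `Y` by a measurable choice of nearby points and average the
resulting coupling over the diagonal action on `X × Y`. Averaging affects neither the first
marginal nor the cost. -/
lemma exists_invariant_wassersteinDist_le [MetricSpace Z] [CompactSpace Z] [MeasurableSpace Z]
    [BorelSpace Z] [IsIsometricSMul G X] [IsIsometricSMul G Y] {p : ℝ} (hp : 0 < p)
    {i : X → Z} {j : Y → Z} (hi : Continuous i) (hj : Continuous j)
    (hinv : ∀ (g : G) x y, dist (i (g • x)) (j (g • y)) = dist (i x) (j y))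
    {δ : ℝ} (hδ : ∀ x, ∃ y, dist (i x) (j y) < δ)
    (μ : Measure X) [IsProbabilityMeasure μ] [SMulInvariantMeasure G X μ] :
    ∃ ν : Measure Y, IsProbabilityMeasure ν ∧ SMulInvariantMeasure G Y ν ∧
      wassersteinDist p (μ.map i) (ν.map j) ≤ ENNReal.ofReal δ := by
  have him := hi.measurable
  have hjm := hj.measurable
  have hgX : ∀ g : G, Measurable fun x : X => g • x := fun g =>
    (isometry_smul X g).continuous.measurable
  have hgY : ∀ g : G, Measurable fun y : Y => g • y := fun g =>
    (isometry_smul Y g).continuous.measurable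
  obtain ⟨x₀⟩ : Nonempty X := nonempty_of_isProbabilityMeasure μ
  have hδ0 : 0 ≤ δ := by
    obtain ⟨y, hy⟩ := hδ x₀
    exact dist_nonneg.trans hy.le
  obtain ⟨s, hs, hsδ⟩ := exists_measurable_dist_lt hi hj hδ
  have hgraph : Measurable fun x => (x, s x) := by fun_prop
  have hπ₀ : IsProbabilityMeasure (μ.map fun x => (x, s x)) :=
    Measure.isProbabilityMeasure_map hgraph.aemeasurable
  obtain ⟨π, hπ, hπinv, hπint⟩ := exists_invariant_average (G := G) (μ.map fun x => (x, s x))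
  have hfst : π.map Prod.fst = μ := by
    have : IsProbabilityMeasure (π.map Prod.fst) :=
      Measure.isProbabilityMeasure_map measurable_fst.aemeasurable
    refine ext_of_forall_integral_eq_of_IsFiniteMeasure fun f => ?_
    rw [integral_map measurable_fst.aemeasurable f.continuous.aestronglyMeasurable]
    refine hπint (f.compContinuous ⟨Prod.fst, continuous_fst⟩) _ fun g => ?_
    rw [integral_map hgraph.aemeasurable (by
      refine Measurable.aestronglyMeasurable ?_
      exact f.continuous.measurable.comp ((hgX g).comp measurable_fst))]
    exact (measurePreserving_smul g μ).integral_comp'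
      (f := (Homeomorph.toMeasurableEquiv (IsometryEquiv.constSMul g).toHomeomorph)) f
  let cost : BoundedContinuousFunction (X × Y) ℝ :=
    BoundedContinuousFunction.mkOfCompact ⟨fun z => dist (i z.1) (j z.2) ^ p,
      Continuous.rpow_const (by fun_prop) fun _ => Or.inr hp.le⟩
  have hcost : ∫ z, cost z ∂π ≤ δ ^ p := by
    rw [hπint cost (∫ x, dist (i x) (j (s x)) ^ p ∂μ) fun g => ?_]
    · have := norm_integral_le_of_norm_le_const (μ := μ) (C := δ ^ p)
        (f := fun x => dist (i x) (j (s x)) ^ p) (ae_of_all _ fun x => by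
          rw [Real.norm_of_nonneg (by positivity)]
          exact Real.rpow_le_rpow dist_nonneg (hsδ x).le hp.le)
      exact (Real.le_norm_self _).trans (by simpa using this)
    · have : ∀ z : X × Y, cost (g • z) = cost z := fun z => by
        change dist (i (g • z.1)) (j (g • z.2)) ^ p = dist (i z.1) (j z.2) ^ p
        rw [hinv]
      simp only [this]
      rw [integral_map hgraph.aemeasurable cost.continuous.aestronglyMeasurable]
      rfl
  refine ⟨π.map Prod.snd, Measure.isProbabilityMeasure_map measurable_snd.aemeasurable,
    ⟨fun g A hA => ?_⟩, ?_⟩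
  · rw [Measure.map_apply measurable_snd (hgY g hA), Measure.map_apply measurable_snd hA]
    exact SMulInvariantMeasure.measure_preimage_smul g (measurable_snd hA)
  · refine (wassersteinDist_le_of_mem_couplings hp (π := π.map (Prod.map i j))
      ⟨?_, ?_⟩).trans ?_
    · rw [Measure.map_map measurable_fst (by fun_prop), ← hfst,
        Measure.map_map him measurable_fst]
      rfl
    · rw [Measure.map_map measurable_snd (by fun_prop), Measure.map_map hjm measurable_snd]
      rfl
    · have hcost' : ∫⁻ z, edist (i z.1) (j z.2) ^ p ∂π ≤ ENNReal.ofReal δ ^ p := by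
        rw [ENNReal.ofReal_rpow_of_nonneg hδ0 hp.le]
        refine le_of_eq_of_le ?_ (ENNReal.ofReal_le_ofReal hcost)
        rw [ofReal_integral_eq_lintegral_ofReal (cost.integrable π)
          (ae_of_all _ fun z => Real.rpow_nonneg dist_nonneg p)]
        refine lintegral_congr fun z => ?_
        rw [edist_dist, ENNReal.ofReal_rpow_of_nonneg dist_nonneg hp.le]
        rfl
      have hmap : ∫⁻ z, edist z.1 z.2 ^ p ∂(π.map (Prod.map i j)) =
          ∫⁻ z, edist (i z.1) (j z.2) ^ p ∂π :=
        lintegral_map (by fun_prop) (by fun_prop)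
      rw [hmap, one_div, ENNReal.rpow_inv_le_iff hp]
      exact hcost'

end Comparison

section GromovHausdorff

universe u v

variable {G : Type*} {X : Type u} {Y : Type v} [Group G]
  [MetricSpace X] [CompactSpace X] [MeasurableSpace X] [BorelSpace X] [MulAction G X]
  [MetricSpace Y] [CompactSpace Y] [MeasurableSpace Y] [BorelSpace Y] [MulAction G Y]
  [IsIsometricSMul G X] [IsIsometricSMul G Y]

/-- The Gromov-Hausdorff distance between the spaces of invariant measures is at most `δ` if `X`
and `Y` embed in a compact space at Hausdorff distance less than `δ` with `d(i x, j y)` invariant: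
the space of probability measures on `Z` serves as the common metric space. -/
lemma gromovHausdorffDist_invariantPp_le {Z : Type (max u v)} [MetricSpace Z] [CompactSpace Z]
    [MeasurableSpace Z] [BorelSpace Z] {p : ℝ} (hp : 1 ≤ p)
    {i : X → Z} {j : Y → Z} (hi : Isometry i) (hj : Isometry j)
    (hinv : ∀ (g : G) x y, dist (i (g • x)) (j (g • y)) = dist (i x) (j y))
    {δ : ℝ} (hδX : ∀ x, ∃ y, dist (i x) (j y) < δ) (hδY : ∀ y, ∃ x, dist (j y) (i x) < δ) :
    gromovHausdorffDist (InvariantPp.wDist G X p) (InvariantPp.wDist G Y p) ≤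
      ENNReal.ofReal δ := by
  have hp0 : 0 < p := by linarith
  let φ : InvariantPp G X p → ProbabilityMeasure Z := fun μ =>
    ⟨μ.1.map i, have := μ.2.1; Measure.isProbabilityMeasure_map hi.continuous.aemeasurable⟩
  let ψ : InvariantPp G Y p → ProbabilityMeasure Z := fun ν =>
    ⟨ν.1.map j, have := ν.2.1; Measure.isProbabilityMeasure_map hj.continuous.aemeasurable⟩
  let m : MetricSpace (ProbabilityMeasure Z) := wassersteinMetricSpace Z hp
  refine iInf_le_of_le (ProbabilityMeasure Z) <| iInf_le_of_le m <|
    iInf_le_of_le φ <| iInf_le_of_le ψ <|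
    iInf_le_of_le (fun μ μ' => have := μ.2.1; wassersteinDist_map_eq hp0 hi μ.1 μ'.1) <|
    iInf_le_of_le (fun ν ν' => have := ν.2.1; wassersteinDist_map_eq hp0 hj ν.1 ν'.1) ?_
  refine Metric.hausdorffEDist_le_of_mem_edist ?_ ?_
  · rintro _ ⟨⟨μ, h1, -, h3⟩, rfl⟩
    obtain ⟨ν, hν1, hν2, hν⟩ := exists_invariant_wassersteinDist_le hp0
      hi.continuous hj.continuous hinv hδX μ
    exact ⟨_, ⟨⟨ν, hν1, exists_lintegral_edist_rpow_lt_top hp0 ν, hν2⟩, rfl⟩, hν⟩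
  · rintro _ ⟨⟨ν, h1, -, h3⟩, rfl⟩
    obtain ⟨μ, hμ1, hμ2, hμ⟩ := exists_invariant_wassersteinDist_le hp0
      hj.continuous hi.continuous (fun g y x => by rw [dist_comm, hinv, dist_comm]) hδY ν
    exact ⟨_, ⟨⟨μ, hμ1, exists_lintegral_edist_rpow_lt_top hp0 μ, hμ2⟩, rfl⟩, hμ⟩

/-- Glue `X` to `Y` along the `G`-orbit of the graph of `f`, that is, with `g • x` placed at
distance `2ε` from `g • f x`. Translating the gluing data by `G` makes the distance between points
of `X` and points of `Y` invariant. -/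
lemma gromovHausdorffDist_invariantPp_le_of_approx {p : ℝ} (hp : 1 ≤ p) {ε : ℝ} (hε : 0 < ε)
    {f : X → Y} (hf : IsEquivariantGHApprox G ε f) :
    gromovHausdorffDist (InvariantPp.wDist G X p) (InvariantPp.wDist G Y p) ≤
      ENNReal.ofReal (4 * ε) := by
  obtain ⟨⟨hdist, hsurj⟩, hequiv⟩ := hf
  rcases isEmpty_or_nonempty X with hX | hX
  -- If `X` is empty then so is `Y`, and any space, here a point, serves as common space.
  · have hY : IsEmpty Y := ⟨fun y => hX.elim (hsurj y).choose⟩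
    let _ : MeasurableSpace PUnit.{max u v + 1} := borel _
    have : BorelSpace PUnit.{max u v + 1} := ⟨rfl⟩
    exact gromovHausdorffDist_invariantPp_le (Z := PUnit.{max u v + 1}) hp
      (i := fun x => hX.elim x) (j := fun y => hY.elim y) (fun x => hX.elim x)
      (fun y => hY.elim y) (fun _ x => hX.elim x) (fun x => hX.elim x) (fun y => hY.elim y)
  · let Φ : G × X → X := fun q => q.1 • q.2
    let Ψ : G × X → Y := fun q => q.1 • f q.2
    -- The distortion of the orbit of the graph is at most `3ε`: one `ε` from `f` itself and one for
    -- each of the two translated points.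
    have H : ∀ q q', |dist (Φ q) (Φ q') - dist (Ψ q) (Ψ q')| ≤ 2 * (2 * ε) := by
      rintro ⟨g, x⟩ ⟨g', x'⟩
      have h1 := abs_le.1 (hdist (g • x) (g' • x'))
      have h2 := hequiv g x
      have h3 := hequiv g' x'
      have h4 := dist_dist_dist_le (g • f x) (g' • f x') (f (g • x)) (f (g' • x'))
      rw [Real.dist_eq] at h4
      have h5 := abs_le.1 h4
      simp only [Φ, Ψ]
      rw [abs_le]
      constructor <;> linarith
    let m : MetricSpace (X ⊕ Y) := Metric.glueMetricApprox Φ Ψ (2 * ε) (by positivity) H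
    let _ : MeasurableSpace (X ⊕ Y) := borel _
    have : BorelSpace (X ⊕ Y) := ⟨rfl⟩
    have hc : CompactSpace (X ⊕ Y) := inferInstance
    have hglue : ∀ x, dist (Sum.inl x : X ⊕ Y) (Sum.inr (f x)) = 2 * ε := fun x => by
      have h := Metric.glueDist_glued_points Φ Ψ (2 * ε) (1, x)
      simp only [Φ, Ψ, one_smul] at h
      exact h
    refine gromovHausdorffDist_invariantPp_le (Z := X ⊕ Y) hp (i := Sum.inl) (j := Sum.inr)
      (Isometry.of_dist_eq fun _ _ => rfl) (Isometry.of_dist_eq fun _ _ => rfl)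
      (fun g x y => ?_) (fun x => ⟨f x, ?_⟩) fun y => ?_
    · change (⨅ q, dist (g • x) (Φ q) + dist (g • y) (Ψ q)) + 2 * ε =
        (⨅ q, dist x (Φ q) + dist y (Ψ q)) + 2 * ε
      congr 1
      refine (Equiv.iInf_congr ((Equiv.mulLeft g).prodCongr (Equiv.refl X)) fun q => ?_).symm
      simp [Φ, Ψ, mul_smul]
    · rw [hglue]
      linarith
    · obtain ⟨x, hx⟩ := hsurj y
      refine ⟨x, ?_⟩
      have h1 : dist (Sum.inr y : X ⊕ Y) (Sum.inr (f x)) = dist y (f x) := rfl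
      have h2 := dist_triangle_right (Sum.inr y : X ⊕ Y) (Sum.inl x) (Sum.inr (f x))
      rw [h1, hglue] at h2
      linarith

end GromovHausdorff

/-! ### Isometry of the limit action and convergence -/

/-- Compare `d(g • y, g • y')` with `d(h y, h y')`: conjugating by `h` costs `ε` for each of the two
distances compared and `ε` for each of the two points translated. -/
lemma abs_dist_smul_sub_dist_le {G X Y : Type*} [Group G] [MetricSpace X] [MetricSpace Y]
    [MulAction G X] [MulAction G Y] [IsIsometricSMul G X] {ε : ℝ} {h : Y → X}
    (hh : IsEquivariantGHApprox G ε h) (g : G) (y y' : Y) :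
    |dist (g • y) (g • y') - dist y y'| ≤ 4 * ε := by
  obtain ⟨⟨hdist, -⟩, hequiv⟩ := hh
  have h1 := abs_le.1 (hdist (g • y) (g • y'))
  have h2 := abs_le.1 (hdist y y')
  have h3 := hequiv g y
  have h4 := hequiv g y'
  have h5 := dist_dist_dist_le (g • h y) (g • h y') (h (g • y)) (h (g • y'))
  rw [Real.dist_eq, dist_smul] at h5
  have h6 := abs_le.1 h5
  rw [abs_le]
  constructor <;> linarith

lemma exists_approx_of_equivariantGHDist_lt {G X Y : Type*} [Group G] [MetricSpace X]
    [MetricSpace Y] [MulAction G X] [MulAction G Y] {ε : ℝ}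
    (h : equivariantGHDist G X Y < ENNReal.ofReal ε) :
    ∃ δ : ℝ, 0 < δ ∧ δ < ε ∧ (∃ f : X → Y, IsEquivariantGHApprox G δ f) ∧
      ∃ h : Y → X, IsEquivariantGHApprox G δ h := by
  simp only [equivariantGHDist, iInf_lt_iff] at h
  obtain ⟨δ, hδ, hf, hh, hlt⟩ := h
  exact ⟨δ, hδ, (ENNReal.ofReal_lt_ofReal_iff_of_nonneg hδ.le).1 hlt, hf, hh⟩

theorem theorem1p3 {G : Type*} [Group G] [TopologicalSpace G] [IsTopologicalGroup G]
    [LocallyCompactSpace G] [SigmaCompactSpace G] [MeasurableSpace G] [BorelSpace G]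
    (hG : IsAmenableGroup G)
    {X : ℕ → Type*} [∀ n, MetricSpace (X n)] [∀ n, CompactSpace (X n)]
    [∀ n, MeasurableSpace (X n)] [∀ n, BorelSpace (X n)]
    [∀ n, MulAction G (X n)] [∀ n, IsIsometricSMul G (X n)]
    {Y : Type*} [MetricSpace Y] [CompactSpace Y] [MeasurableSpace Y] [BorelSpace Y]
    [MulAction G Y]
    (hlim : Tendsto (fun n => equivariantGHDist G (X n) Y) atTop (𝓝 0)) :
    IsIsometricSMul G Y ∧
      ∀ p : ℝ, 1 ≤ p →
        Tendsto (fun n => gromovHausdorffDist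
          (InvariantPp.wDist G (X n) p) (InvariantPp.wDist G Y p)) atTop (𝓝 0) := by
  have happrox : ∀ ε : ℝ, 0 < ε → ∀ᶠ n in atTop, ∃ δ : ℝ, 0 < δ ∧ δ < ε ∧
      (∃ f : X n → Y, IsEquivariantGHApprox G δ f) ∧
      ∃ h : Y → X n, IsEquivariantGHApprox G δ h := fun ε hε => by
    filter_upwards [hlim.eventually_lt_const (ENNReal.ofReal_pos.2 hε)] with n hn
    exact exists_approx_of_equivariantGHDist_lt hn
  have hY : IsIsometricSMul G Y := by
    refine ⟨fun g => Isometry.of_dist_eq fun y y' => ?_⟩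
    refine eq_of_abs_sub_le_all fun ε hε => ?_
    obtain ⟨n, δ, -, hδ, -, h, hh⟩ := (happrox (ε / 4) (by positivity)).exists
    linarith [abs_dist_smul_sub_dist_le hh g y y']
  refine ⟨hY, fun p hp => ENNReal.tendsto_nhds_zero.2 fun ε hε => ?_⟩
  obtain ⟨r, hr, hrε⟩ := ENNReal.lt_iff_exists_nnreal_btwn.1 hε
  have hr' : (0 : ℝ) < r := by exact_mod_cast hr
  filter_upwards [happrox (r / 4) (by positivity)] with n hn
  obtain ⟨δ, hδ0, hδ, ⟨f, hf⟩, -⟩ := hn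
  refine (gromovHausdorffDist_invariantPp_le_of_approx hp hδ0 hf).trans (le_trans ?_ hrε.le)
  rw [← ENNReal.ofReal_coe_nnreal]
  exact ENNReal.ofReal_le_ofReal (by linarith)
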